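/- Let $k$ be a field and let $\Omega=\bigcup_{n\ge1}\Omega_n$ be a set of operation symbols, the elements of $\Omega_n$ being $n$-ary. An associative $\Omega$-algebra over $k$ is an associative $k$-algebra (not necessarily with unit) together with a $k$-multilinear operation $\delta:A^n\to A$ for every $\delta\in\Omega_n$, $n\ge1$ (no identities are imposed on these operations). Homomorphisms are the $k$-linear multiplicative maps commuting with all operations. An ideal is a $k$-subspace $I$ with $AI\subseteq I$, $IA\subseteq I$ and $\delta(a_1,\dots,a_n)\in I$ whenever some $a_i\in I$; $A$ is simple if $A^2\neq0$ and $0$ and $A$ are its only ideals. For a set $X$, $k\langle X;\Omega\rangle$ denotes the free associative $\Omega$-algebra on $X$, with basis the nonempty $\Omega$-words on $X$, and $k\langle X;\Omega\mid S\rangle$ its quotient by the ideal generated by $S$. **Theorem.** For every associative $\Omega$-algebra $A$ over $k$ there are a simple associative $\Omega$-algebra $\mathcal A$ over $k$ and an injective homomorphism $A\to\mathcal A$. If moreover $A\ne0$, then $\mathcal A$ can be obtained as the union $\mathcal A=\bigcup_{n\ge0}A_n$ of an ascending chain of $\Omega$-subalgebras $A_0\subseteq A_1\subseteq A_2\subseteq\cdots$,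 where $A_0$ is the image of $A$ and each $A_{n+1}$ arises from $A_n$ as follows. For a suitable basis $(x_i)_{i\in I}$ of $A_n$ indexed by a well-ordered set $I$, let $(f_\theta)_{\theta\in T}$ be the family of all monic elements of $A_n$, i.e. the elements $f$ for which the coefficient of the largest $x_i$ occurring in $f$ is $1$. Then, for suitable elements $x_{\theta\sigma},y_{\theta\sigma}\in A_{n+1}$ ($\theta,\sigma\in T$), $$A_{n+1}=k\langle\, x_i,\ x_{\theta\sigma},\ y_{\theta\sigma}\ (i\in I,\ \theta,\sigma\in T)\,;\ \Omega\mid S_1\rangle ,$$ where the letters $x_i$ correspond to the elements $x_i\in A_n\subseteq A_{n+1}$, and $S_1$ consists of the relations $x_ix_j=\{x_i,x_j\}$ and $\delta(x_{i_1},\dots,x_{i_m})=\{\delta(x_{i_1},\dots,x_{i_m})\}$ for all $i,j,i_1,\dots,i_m\in I$, $\delta\in\Omega_m$, $m\ge1$ (the braces denoting the value in $A_n$, written as a linear combination of the $x_i$), and of the relations $$x_{\theta\sigma}\,f_\theta\,y_{\theta\sigma}=f_\sigma\qquad(\theta,\sigma\in T),$$ where each $f_\theta$ is written as a linear combination of the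 $x_i$. -/

import Mathlib

universe u v w

/-- An (associative) `Ω`-algebra over the field `k`: a not necessarily unital associative `k`-algebra
`A` together with a `k`-multilinear operation `A ^ n → A` for every `δ ∈ Ω n`, `n ≥ 1`.  No
identities are imposed on the operations.  (That the multiplication of `A` is associative and
`k`-bilinear is expressed by the usual classes `NonUnitalRing A`, `Module k A`,
`IsScalarTower k A A` and `SMulCommClass k A A`.) -/
class OmegaAlgebra (k : Type v) (Ω : ℕ+ → Type w) (A : Type u)
    [Field k] [NonUnitalRing A] [Module k A] where
  opMap : ∀ {n : ℕ+}, Ω n → MultilinearMap k (fun _ : Fin (n : ℕ) => A) A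

namespace OmegaAlgebra

/-- The operation of arity `n` belonging to `δ ∈ Ω n`. -/
abbrev op (k : Type*) [Field k] {Ω : ℕ+ → Type*} {A : Type*} [NonUnitalRing A] [Module k A]
    [OmegaAlgebra k Ω A] {n : ℕ+} (δ : Ω n) : MultilinearMap k (fun _ : Fin (n : ℕ) => A) A :=
  OmegaAlgebra.opMap δ

section Basic

variable (k : Type*) [Field k] (Ω : ℕ+ → Type*)

/-- Homomorphisms of `Ω`-algebras: `k`-linear, multiplicative, compatible with the operations. -/
structure Hom (A B : Type*)
    [NonUnitalRing A] [Module k A] [OmegaAlgebra k Ω A]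
    [NonUnitalRing B] [Module k B] [OmegaAlgebra k Ω B] extends A →ₙₐ[k] B where
  map_op' : ∀ {n : ℕ+} (δ : Ω n) (a : Fin (n : ℕ) → A),
    toFun (op k δ a) = op k δ (fun i => toFun (a i))

instance {A B : Type*}
    [NonUnitalRing A] [Module k A] [OmegaAlgebra k Ω A]
    [NonUnitalRing B] [Module k B] [OmegaAlgebra k Ω B] :
    CoeFun (Hom k Ω A B) (fun _ => A → B) :=
  ⟨fun f => f.toNonUnitalAlgHom⟩

/-- Ideals of an `Ω`-algebra: linear subspaces `I` that are two-sided ideals, and such that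
`δ (a₁, …, aₙ) ∈ I` as soon as one of the arguments lies in `I`. -/
structure Ideal (A : Type*) [NonUnitalRing A] [Module k A] [OmegaAlgebra k Ω A]
    extends Submodule k A where
  mul_left_mem' : ∀ (a : A) {x : A}, x ∈ carrier → a * x ∈ carrier
  mul_right_mem' : ∀ (a : A) {x : A}, x ∈ carrier → x * a ∈ carrier
  op_mem' : ∀ {n : ℕ+} (δ : Ω n) (a : Fin (n : ℕ) → A) (i : Fin (n : ℕ)),
    a i ∈ carrier → op k δ a ∈ carrier

/-- The ideal generated by a subset of an `Ω`-algebra: the intersection of all ideals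
containing it. -/
def idealSpan {A : Type*} [NonUnitalRing A] [Module k A] [OmegaAlgebra k Ω A] (S : Set A) :
    Ideal k Ω A where
  carrier := {x | ∀ I : Ideal k Ω A, S ⊆ I.carrier → x ∈ I.carrier}
  add_mem' hx hy I hI := I.add_mem' (hx I hI) (hy I hI)
  zero_mem' I _ := I.zero_mem'
  smul_mem' c _ hx I hI := I.smul_mem' c (hx I hI)
  mul_left_mem' a _ hx I hI := I.mul_left_mem' a (hx I hI)
  mul_right_mem' a _ hx I hI := I.mul_right_mem' a (hx I hI)
  op_mem' δ a i hx I hI := I.op_mem' δ a i (hx I hI)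

/-- An `Ω`-algebra `A` is simple if `A² ≠ 0` and `0` and `A` are its only ideals. -/
structure IsSimple (A : Type*) [NonUnitalRing A] [Module k A] [OmegaAlgebra k Ω A] : Prop where
  exists_mul_ne_zero : ∃ a b : A, a * b ≠ 0
  eq_bot_or_eq_top : ∀ I : Ideal k Ω A, I.toSubmodule = ⊥ ∨ I.toSubmodule = ⊤

/-- `Ω`-subalgebras. -/
structure Subalg (A : Type*) [NonUnitalRing A] [Module k A] [OmegaAlgebra k Ω A]
    extends NonUnitalSubalgebra k A where
  op_mem' : ∀ {n : ℕ+} (δ : Ω n) (a : Fin (n : ℕ) → A),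
    (∀ i, a i ∈ carrier) → op k δ a ∈ carrier

variable {k Ω}

/-- An `Ω`-subalgebra is itself an `Ω`-algebra. -/
instance {A : Type*} [NonUnitalRing A] [Module k A] [OmegaAlgebra k Ω A] (C : Subalg k Ω A) :
    OmegaAlgebra k Ω C.toNonUnitalSubalgebra where
  opMap δ :=
    { toFun := fun a => ⟨op k δ (fun i => (a i : A)), C.op_mem' δ _ (fun i => (a i).2)⟩
      map_update_add' := by
        intro _ a i x y
        apply Subtype.ext
        have h : ∀ z, (fun j => ((Function.update a i z j : C.toNonUnitalSubalgebra) : A))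
            = Function.update (fun j => (a j : A)) i (z : A) := fun z =>
          funext fun j => Function.apply_update (fun _ (t : C.toNonUnitalSubalgebra) => (t : A))
            a i z j
        simp only [NonUnitalSubalgebra.coe_add, h, MultilinearMap.map_update_add]
      map_update_smul' := by
        intro _ a i c x
        apply Subtype.ext
        have h : ∀ z, (fun j => ((Function.update a i z j : C.toNonUnitalSubalgebra) : A))
            = Function.update (fun j => (a j : A)) i (z : A) := fun z =>
          funext fun j => Function.apply_update (fun _ (t : C.toNonUnitalSubalgebra) => (t : A))
            a i z j
        simp only [NonUnitalSubalgebra.coe_smul, h, MultilinearMap.map_update_smul] }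

/-- The inclusion homomorphism between two `Ω`-subalgebras. -/
def Subalg.inclusion {A : Type*} [NonUnitalRing A] [Module k A] [OmegaAlgebra k Ω A]
    {C D : Subalg k Ω A} (h : C.toNonUnitalSubalgebra ≤ D.toNonUnitalSubalgebra) :
    Hom k Ω C.toNonUnitalSubalgebra D.toNonUnitalSubalgebra where
  toNonUnitalAlgHom := NonUnitalSubalgebra.inclusion h
  map_op' _ _ := rfl

end Basic

/-! The free `Ω`-algebra on a set `X`. -/

/-- The `Ω`-words on `X`: the nonempty words in the letters `x ∈ X` and `δ (u₁, …, uₙ)`, where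
`δ ∈ Ω n` and the `uᵢ` are again `Ω`-words.  The constructors are: the one-letter words `x` and
`δ (u₁, …, uₙ)`, and the words `x · v` and `δ (u₁, …, uₙ) · v` with `v` an `Ω`-word. -/
inductive Word (Ω : ℕ+ → Type w) (X : Type u) : Type (max u w)
  | var (x : X) : Word Ω X
  | op {n : ℕ+} (δ : Ω n) (u : Fin (n : ℕ) → Word Ω X) : Word Ω X
  | varMul (x : X) (v : Word Ω X) : Word Ω X
  | opMul {n : ℕ+} (δ : Ω n) (u : Fin (n : ℕ) → Word Ω X) (v : Word Ω X) : Word Ω X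

namespace Word

variable {Ω : ℕ+ → Type*} {X : Type*}

/-- Concatenation of `Ω`-words. -/
protected def mul : Word Ω X → Word Ω X → Word Ω X
  | var x, t => varMul x t
  | op δ u, t => opMul δ u t
  | varMul x v, t => varMul x (Word.mul v t)
  | opMul δ u v, t => opMul δ u (Word.mul v t)

instance : Mul (Word Ω X) := ⟨Word.mul⟩

protected theorem mul_assoc' (s t r : Word Ω X) :
    Word.mul (Word.mul s t) r = Word.mul s (Word.mul t r) := by
  induction s with
  | var x => rfl
  | op δ u _ => rfl
  | varMul x v ih => simp only [Word.mul, ih]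
  | opMul δ u v _ ih => simp only [Word.mul, ih]

instance : Semigroup (Word Ω X) where
  mul_assoc := Word.mul_assoc'

end Word

section Free

variable (k : Type*) [Field k] (Ω : ℕ+ → Type*) (X : Type*)

/-- The free `Ω`-algebra `k⟨X; Ω⟩`: the `k`-vector space with basis the `Ω`-words on `X`, the
product extending the concatenation of words. -/
abbrev Free := MonoidAlgebra k (Word Ω X)

/-- The operations of `k⟨X; Ω⟩`: the multilinear extension of
`(u₁, …, uₙ) ↦ δ (u₁, …, uₙ)` on words. -/
noncomputable instance : OmegaAlgebra k Ω (Free k Ω X) where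
  opMap {n} δ :=
    ((Basis.piTensorProduct (fun _ : Fin (n : ℕ) => MonoidAlgebra.basis (Word Ω X) k)).constr k
      (fun u => (MonoidAlgebra.single (Word.op δ u) 1 : Free k Ω X))).compMultilinearMap
        (PiTensorProduct.tprod k)

theorem Free.op_single {n : ℕ+} (δ : Ω n) (u : Fin (n : ℕ) → Word Ω X) :
    op k δ (fun i => (MonoidAlgebra.single (u i) 1 : Free k Ω X))
      = MonoidAlgebra.single (Word.op δ u) 1 := by
  have h := (Basis.piTensorProduct
    (fun _ : Fin (n : ℕ) => MonoidAlgebra.basis (Word Ω X) k)).constr_basis k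
      (fun u => (MonoidAlgebra.single (Word.op δ u) 1 : Free k Ω X)) u
  rw [Basis.piTensorProduct_apply] at h
  simpa [op, opMap] using h

variable {X}

/-- The generator of `k⟨X; Ω⟩` corresponding to `x ∈ X`. -/
noncomputable def Free.of (x : X) : Free k Ω X := MonoidAlgebra.single (Word.var x) 1

variable {k Ω}

/-- `A = k⟨X; Ω | S⟩` via `φ : X → A`: the homomorphism `k⟨X; Ω⟩ → A` extending `φ` is surjective
and its kernel is the ideal generated by `S`. -/
def IsPresentation {A : Type*} [NonUnitalRing A] [Module k A] [OmegaAlgebra k Ω A]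
    (φ : X → A) (S : Set (Free k Ω X)) : Prop :=
  ∃ π : Hom k Ω (Free k Ω X) A, (∀ x, π (Free.of k Ω x) = φ x) ∧ Function.Surjective π ∧
    ∀ f, π f = 0 ↔ f ∈ (idealSpan k Ω S).toSubmodule

end Free

section Step

variable {k : Type*} [Field k] {Ω : ℕ+ → Type*} {A : Type*}
  [NonUnitalRing A] [Module k A] {I : Type*} [LinearOrder I]

/-- The monic elements of `A` with respect to a basis indexed by an ordered set: the elements in
which the greatest basis element that occurs has coefficient `1`. -/
def Monic (b : Module.Basis I k A) : Type _ :=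
  {f : A // ∃ i, b.repr f i = 1 ∧ ∀ j, i < j → b.repr f j = 0}

/-- The letters `xᵢ` (`i ∈ I`), `x_{θσ}` and `y_{θσ}` (`θ, σ ∈ T`). -/
inductive StepLetter (I T : Type*)
  | base (i : I)
  | left (θ σ : T)
  | right (θ σ : T)

variable [OmegaAlgebra k Ω A]

/-- An element of `A`, written as a linear combination of the basis `xᵢ` and regarded as an
element of the free `Ω`-algebra on the letters `xᵢ, x_{θσ}, y_{θσ}`. -/
noncomputable def stepLift (Ω : ℕ+ → Type*) (b : Module.Basis I k A) :
    A →ₗ[k] Free k Ω (StepLetter I (Monic b)) :=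
  b.constr k (fun i => Free.of k Ω (.base i))

/-- The relations `xᵢ xⱼ = {xᵢ, xⱼ}`, `δ (x_{i₁}, …, x_{iₙ}) = {δ (x_{i₁}, …, x_{iₙ})}` (the right
hand sides being the values in `A`, expanded in the basis) and `x_{θσ} f_θ y_{θσ} = f_σ`, where
`f_θ, f_σ` run through the monic elements of `A`.  A relation `l = r` is recorded as `l - r`. -/
def stepRelations (b : Module.Basis I k A) : Set (Free k Ω (StepLetter I (Monic b))) :=
  {f | ∃ i j, f = Free.of k Ω (.base i) * Free.of k Ω (.base j) - stepLift Ω b (b i * b j)} ∪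
  {f | ∃ (n : ℕ+) (δ : Ω n) (c : Fin (n : ℕ) → I),
    f = op k δ (fun m => Free.of k Ω (.base (c m))) - stepLift Ω b (op k δ (fun m => b (c m)))} ∪
  {f | ∃ θ σ : Monic b,
    f = Free.of k Ω (.left θ σ) * stepLift Ω b θ.1 * Free.of k Ω (.right θ σ) - stepLift Ω b σ.1}

/-- The homomorphism `j : A → A'` exhibits `A'` as the `Ω`-algebra obtained from `A` by adjoining,
for every pair `(f_θ, f_σ)` of monic elements of `A`, letters `x_{θσ}, y_{θσ}` with
`x_{θσ} f_θ y_{θσ} = f_σ`.  Monic refers to some basis `(xᵢ)` of `A` indexed by a well-ordered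
set, and `A'` is presented by the letters `xᵢ, x_{θσ}, y_{θσ}` and the relations
`stepRelations`. -/
def IsStep {A A' : Type u} [NonUnitalRing A] [Module k A] [OmegaAlgebra k Ω A]
    [NonUnitalRing A'] [Module k A'] [OmegaAlgebra k Ω A'] (j : Hom k Ω A A') : Prop :=
  ∃ (I : Type u) (_ : LinearOrder I) (_ : WellFoundedLT I) (b : Module.Basis I k A)
    (φ : StepLetter I (Monic b) → A'),
    (∀ i, φ (.base i) = j (b i)) ∧ IsPresentation φ (stepRelations (Ω := Ω) b)

end Step

end OmegaAlgebra

namespace OmegaAlgebra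

/-! ### Homomorphisms, ideals and ranges -/

section Basic

variable {k : Type*} [Field k] {Ω : ℕ+ → Type*}

/-! If in a nonzero algebra every equation `x * f * y = g` with `f ≠ 0` has a solution, the algebra
is simple: a nonzero ideal contains every `g`, and `g = f ≠ 0` gives a nonzero product. A step makes
all these equations, with `f` and `g` in the old algebra, solvable in the new one; nonzero elements
are multiples of monic ones, so the relations for monic pairs suffice (`IsStep.exists_mul_mul_eq`).
In the union of a chain of steps any `f` and `g` lie in a common stage, so the union is simple
(`isSimple_of_chain`).

The crux is that a step does not collapse the old algebra `A`. No normal form of words is computed;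
it is enough to have one model, an algebra `E` containing `A` in which the equations are solvable
(`exists_envelope`). The homomorphism from the free algebra to `E` kills the relations and restricts
on `A` to an injection, so `A` embeds into the presented algebra (`exists_isStep`).

For `E` take the linear endomorphisms of a direct sum of copies of the unitization of `A`, on which
`A` acts by left multiplication. The sum is large enough to send its basis vectors to the units of
distinct copies, and this solves the equations (`exists_mul_lsmul_mul`). Since the operations
satisfy no identities, those of `A` extend to `E` along any linear projection of `E` onto `A`.

The zero algebra embeds into every simple algebra, and one is obtained by starting the chain at `k`.
-/

theorem op_zero {A : Type*} [NonUnitalRing A] [Module k A] [OmegaAlgebra k Ω A] {n : ℕ+}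
    (δ : Ω n) : op k δ (fun _ => (0 : A)) = 0 :=
  (op k δ).map_coord_zero (⟨0, n.pos⟩ : Fin (n : ℕ)) rfl

theorem Hom.map_op {A B : Type*}
    [NonUnitalRing A] [Module k A] [OmegaAlgebra k Ω A]
    [NonUnitalRing B] [Module k B] [OmegaAlgebra k Ω B] (f : Hom k Ω A B) {n : ℕ+} (δ : Ω n)
    (a : Fin (n : ℕ) → A) : f (op k δ a) = op k δ (fun i => f (a i)) :=
  f.map_op' δ a

/-- Composition of homomorphisms. -/
def Hom.comp {A B C : Type*}
    [NonUnitalRing A] [Module k A] [OmegaAlgebra k Ω A]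
    [NonUnitalRing B] [Module k B] [OmegaAlgebra k Ω B]
    [NonUnitalRing C] [Module k C] [OmegaAlgebra k Ω C]
    (g : Hom k Ω B C) (f : Hom k Ω A B) : Hom k Ω A C where
  toNonUnitalAlgHom := g.toNonUnitalAlgHom.comp f.toNonUnitalAlgHom
  map_op' δ a := by
    change g (f _) = op k δ (fun i => g (f (a i)))
    rw [f.map_op, g.map_op]

@[simp] theorem Hom.comp_apply {A B C : Type*}
    [NonUnitalRing A] [Module k A] [OmegaAlgebra k Ω A]
    [NonUnitalRing B] [Module k B] [OmegaAlgebra k Ω B]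
    [NonUnitalRing C] [Module k C] [OmegaAlgebra k Ω C]
    (g : Hom k Ω B C) (f : Hom k Ω A B) (a : A) : g.comp f a = g (f a) := rfl

/-- The inverse of a bijective homomorphism. -/
noncomputable def Hom.inverse {A B : Type*}
    [NonUnitalRing A] [Module k A] [OmegaAlgebra k Ω A]
    [NonUnitalRing B] [Module k B] [OmegaAlgebra k Ω B]
    (f : Hom k Ω A B) (hf : Function.Bijective f) : Hom k Ω B A where
  toFun := Function.surjInv hf.2
  map_smul' c x := hf.1 (by simp [map_smul f.toNonUnitalAlgHom, Function.surjInv_eq hf.2])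
  map_zero' := hf.1 (by simp [Function.surjInv_eq hf.2])
  map_add' x y := hf.1 (by simp [map_add f.toNonUnitalAlgHom, Function.surjInv_eq hf.2])
  map_mul' x y := hf.1 (by simp [map_mul f.toNonUnitalAlgHom, Function.surjInv_eq hf.2])
  map_op' δ a := hf.1 (by simp [f.map_op, Function.surjInv_eq hf.2])

theorem Hom.apply_inverse {A B : Type*}
    [NonUnitalRing A] [Module k A] [OmegaAlgebra k Ω A]
    [NonUnitalRing B] [Module k B] [OmegaAlgebra k Ω B]
    (f : Hom k Ω A B) (hf : Function.Bijective f) (b : B) : f (f.inverse hf b) = b :=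
  Function.surjInv_eq hf.2 b

theorem Hom.inverse_apply {A B : Type*}
    [NonUnitalRing A] [Module k A] [OmegaAlgebra k Ω A]
    [NonUnitalRing B] [Module k B] [OmegaAlgebra k Ω B]
    (f : Hom k Ω A B) (hf : Function.Bijective f) (a : A) : f.inverse hf (f a) = a :=
  hf.1 (f.apply_inverse hf (f a))

/-- The preimage of an ideal under a homomorphism. -/
def Ideal.comap {A B : Type*}
    [NonUnitalRing A] [Module k A] [OmegaAlgebra k Ω A]
    [NonUnitalRing B] [Module k B] [OmegaAlgebra k Ω B]
    (f : Hom k Ω A B) (J : Ideal k Ω B) : Ideal k Ω A where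
  carrier := {a | f a ∈ J.carrier}
  add_mem' {x y} hx hy := by
    change f (x + y) ∈ J.carrier
    rw [map_add]; exact J.add_mem' hx hy
  zero_mem' := by
    change f 0 ∈ J.carrier
    rw [map_zero]; exact J.zero_mem'
  smul_mem' c x hx := by
    change f (c • x) ∈ J.carrier
    rw [map_smul]; exact J.smul_mem' c hx
  mul_left_mem' a x hx := by
    change f (a * x) ∈ J.carrier
    rw [map_mul]; exact J.mul_left_mem' _ hx
  mul_right_mem' a x hx := by
    change f (x * a) ∈ J.carrier
    rw [map_mul]; exact J.mul_right_mem' _ hx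
  op_mem' δ a i hi := by
    change f (op k δ a) ∈ J.carrier
    rw [f.map_op]; exact J.op_mem' δ _ i hi

/-- The zero ideal. -/
def Ideal.zero (A : Type*) [NonUnitalRing A] [Module k A] [OmegaAlgebra k Ω A] : Ideal k Ω A where
  toSubmodule := ⊥
  mul_left_mem' a x hx := by
    obtain rfl : x = 0 := hx
    exact mul_zero a
  mul_right_mem' a x hx := by
    obtain rfl : x = 0 := hx
    exact zero_mul a
  op_mem' δ a i hi := (op k δ).map_coord_zero i hi

theorem subset_idealSpan {A : Type*} [NonUnitalRing A] [Module k A] [OmegaAlgebra k Ω A]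
    (S : Set A) : S ⊆ (idealSpan k Ω S).carrier := fun _ hx _ hI => hI hx

/-- The preimage of `J` is an ideal containing `S`, hence contains the ideal generated by `S`. -/
theorem idealSpan_map_mem {A B : Type*}
    [NonUnitalRing A] [Module k A] [OmegaAlgebra k Ω A]
    [NonUnitalRing B] [Module k B] [OmegaAlgebra k Ω B]
    (f : Hom k Ω A B) {S : Set A} {J : Ideal k Ω B} (h : ∀ s ∈ S, f s ∈ J.toSubmodule) {a : A}
    (ha : a ∈ (idealSpan k Ω S).toSubmodule) : f a ∈ J.toSubmodule :=
  ha (J.comap f) h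

/-- The range of a homomorphism. -/
def Hom.range {A B : Type*}
    [NonUnitalRing A] [Module k A] [OmegaAlgebra k Ω A]
    [NonUnitalRing B] [Module k B] [OmegaAlgebra k Ω B]
    (f : Hom k Ω A B) : Subalg k Ω B where
  toNonUnitalSubalgebra := NonUnitalAlgHom.range f.toNonUnitalAlgHom
  op_mem' δ a ha := by
    choose c hc using ha
    exact ⟨op k δ c, (f.map_op δ c).trans (congrArg _ (funext hc))⟩

/-- A homomorphism, with codomain restricted to its range. -/
def Hom.rangeRestrict {A B : Type*}
    [NonUnitalRing A] [Module k A] [OmegaAlgebra k Ω A]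
    [NonUnitalRing B] [Module k B] [OmegaAlgebra k Ω B]
    (f : Hom k Ω A B) : Hom k Ω A f.range.toNonUnitalSubalgebra where
  toNonUnitalAlgHom := NonUnitalAlgHom.rangeRestrict f.toNonUnitalAlgHom
  map_op' δ a := Subtype.ext (f.map_op δ a)

theorem Hom.rangeRestrict_bijective {A B : Type*}
    [NonUnitalRing A] [Module k A] [OmegaAlgebra k Ω A]
    [NonUnitalRing B] [Module k B] [OmegaAlgebra k Ω B]
    {f : Hom k Ω A B} (hf : Function.Injective f) : Function.Bijective f.rangeRestrict := by
  refine ⟨fun a b h => hf (congrArg Subtype.val h), ?_⟩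
  rintro ⟨_, a, rfl⟩
  exact ⟨a, rfl⟩

end Basic

/-! ### Quotients by ideals -/

section Quotient

variable {k : Type*} [Field k] {Ω : ℕ+ → Type*} {A : Type*} [NonUnitalRing A] [Module k A]
  [OmegaAlgebra k Ω A]

/-- Replace the arguments one at a time: each replacement changes the value by an operation with an
argument in `J`. -/
theorem Ideal.op_sub_op_mem (J : Ideal k Ω A) {n : ℕ+} (δ : Ω n) {a b : Fin (n : ℕ) → A}
    (h : ∀ i, a i - b i ∈ J.toSubmodule) : op k δ a - op k δ b ∈ J.toSubmodule := by
  classical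
  have key : ∀ s : Finset (Fin (n : ℕ)),
      op k δ (s.piecewise a b) - op k δ b ∈ J.toSubmodule := by
    intro s
    induction s using Finset.induction_on with
    | empty => simp
    | insert i s hi ih =>
      rw [Finset.piecewise_insert, ← sub_add_sub_cancel _ (op k δ (s.piecewise a b))]
      refine J.toSubmodule.add_mem ?_ ih
      have hs : op k δ (s.piecewise a b)
          = op k δ (Function.update (s.piecewise a b) i (s.piecewise a b i)) := by
        rw [Function.update_eq_self]
      rw [hs, ← MultilinearMap.map_update_sub]
      refine J.op_mem' δ _ i ?_
      rw [Function.update_self, Finset.piecewise_eq_of_notMem _ _ _ hi]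
      exact h i
  simpa using key Finset.univ

theorem Ideal.mul_sub_mul_mem (J : Ideal k Ω A) {a b c d : A}
    (h : a - b ∈ J.toSubmodule) (h' : c - d ∈ J.toSubmodule) :
    a * c - b * d ∈ J.toSubmodule := by
  have : a * c - b * d = (a - b) * c + b * (c - d) := by
    rw [sub_mul, mul_sub, sub_add_sub_cancel]
  rw [this]
  exact J.toSubmodule.add_mem (J.mul_right_mem' _ h) (J.mul_left_mem' _ h')

/-- The quotient of an `Ω`-algebra by an ideal. -/
def Ideal.Quotient (J : Ideal k Ω A) : Type _ := A ⧸ J.toSubmodule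

namespace Ideal.Quotient

variable (J : Ideal k Ω A)

instance : AddCommGroup J.Quotient := inferInstanceAs (AddCommGroup (A ⧸ J.toSubmodule))

instance : Module k J.Quotient := inferInstanceAs (Module k (A ⧸ J.toSubmodule))

/-- The projection, as a linear map. -/
def proj : A →ₗ[k] J.Quotient := J.toSubmodule.mkQ

theorem proj_surjective : Function.Surjective (proj J) := J.toSubmodule.mkQ_surjective

theorem proj_eq_iff {a b : A} : proj J a = proj J b ↔ a - b ∈ J.toSubmodule :=
  Submodule.Quotient.eq _

/-- A representative. -/
noncomputable def rep (q : J.Quotient) : A := Function.surjInv (proj_surjective J) q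

theorem proj_rep (q : J.Quotient) : proj J (rep J q) = q :=
  Function.surjInv_eq (proj_surjective J) q

theorem rep_sub_mem (a : A) : rep J (proj J a) - a ∈ J.toSubmodule :=
  (proj_eq_iff J).1 (proj_rep J _)

noncomputable instance : Mul J.Quotient := ⟨fun p q => proj J (rep J p * rep J q)⟩

theorem proj_mul (a b : A) : proj J (a * b) = proj J a * proj J b :=
  ((proj_eq_iff J).2 (J.mul_sub_mul_mem (rep_sub_mem J a) (rep_sub_mem J b))).symm

noncomputable instance : NonUnitalRing J.Quotient where
  left_distrib := (proj_surjective J).forall₃.2 fun a b c => by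
    simp only [← map_add, ← proj_mul, mul_add]
  right_distrib := (proj_surjective J).forall₃.2 fun a b c => by
    simp only [← map_add, ← proj_mul, add_mul]
  zero_mul := (proj_surjective J).forall.2 fun a => by
    rw [← map_zero (proj J), ← proj_mul, zero_mul]
  mul_zero := (proj_surjective J).forall.2 fun a => by
    rw [← map_zero (proj J), ← proj_mul, mul_zero]
  mul_assoc := (proj_surjective J).forall₃.2 fun a b c => by
    simp only [← proj_mul, mul_assoc]

instance [IsScalarTower k A A] : IsScalarTower k J.Quotient J.Quotient where
  smul_assoc c := (proj_surjective J).forall₂.2 fun a b => by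
    simp only [smul_eq_mul, ← map_smul, ← proj_mul, smul_mul_assoc]

instance [SMulCommClass k A A] : SMulCommClass k J.Quotient J.Quotient where
  smul_comm c := (proj_surjective J).forall₂.2 fun a b => by
    simp only [smul_eq_mul, ← map_smul, ← proj_mul, mul_smul_comm]

/-- Independence of representatives: the chosen ones may be replaced by any tuple `a`, in particular
by one adapted to an update in a single slot. -/
theorem proj_op {n : ℕ+} (δ : Ω n) (q : Fin (n : ℕ) → J.Quotient) {a : Fin (n : ℕ) → A}
    (h : ∀ i, proj J (a i) = q i) :
    proj J (op k δ (fun i => rep J (q i))) = proj J (op k δ a) :=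
  (proj_eq_iff J).2 (J.op_sub_op_mem δ fun i => (proj_eq_iff J).1 (by rw [proj_rep, h]))

noncomputable instance : OmegaAlgebra k Ω J.Quotient where
  opMap δ :=
    { toFun := fun q => proj J (op k δ (fun i => rep J (q i)))
      map_update_add' := by
        intro _ q i x y
        have h : ∀ z j, proj J (Function.update (fun j => rep J (q j)) i z j)
            = Function.update q i (proj J z) j := fun z j => by
          rw [Function.apply_update (fun _ => proj J)]
          simp only [proj_rep]
        rw [proj_op J δ _ (fun j => (h (rep J x + rep J y) j).trans (by rw [map_add, proj_rep, proj_rep])),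
          proj_op J δ _ (fun j => (h (rep J x) j).trans (by rw [proj_rep])),
          proj_op J δ _ (fun j => (h (rep J y) j).trans (by rw [proj_rep])),
          MultilinearMap.map_update_add, map_add]
      map_update_smul' := by
        intro _ q i c x
        have h : ∀ z j, proj J (Function.update (fun j => rep J (q j)) i z j)
            = Function.update q i (proj J z) j := fun z j => by
          rw [Function.apply_update (fun _ => proj J)]
          simp only [proj_rep]
        rw [proj_op J δ _ (fun j => (h (c • rep J x) j).trans (by rw [map_smul, proj_rep])),
          proj_op J δ _ (fun j => (h (rep J x) j).trans (by rw [proj_rep])),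
          MultilinearMap.map_update_smul, map_smul] }

/-- The projection onto the quotient. -/
def mk : Hom k Ω A J.Quotient where
  toFun := proj J
  map_smul' := (proj J).map_smul
  map_zero' := (proj J).map_zero
  map_add' := (proj J).map_add
  map_mul' := proj_mul J
  map_op' δ _ := (proj_op J δ _ fun _ => rfl).symm

theorem mk_surjective : Function.Surjective (mk J) := proj_surjective J

theorem mk_eq_iff {a b : A} : mk J a = mk J b ↔ a - b ∈ J.toSubmodule := proj_eq_iff J

theorem mk_eq_zero_iff {a : A} : mk J a = 0 ↔ a ∈ J.toSubmodule :=
  Submodule.Quotient.mk_eq_zero _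

end Ideal.Quotient

end Quotient

/-! ### The universal property of the free algebra -/

section FreeLift

variable {k : Type*} [Field k] {Ω : ℕ+ → Type*} {X A : Type*} [NonUnitalRing A] [Module k A]
  [OmegaAlgebra k Ω A]

variable (k) in
/-- The value of an `Ω`-word in an `Ω`-algebra. -/
def Word.eval (φ : X → A) : Word Ω X → A
  | .var x => φ x
  | .op δ u => OmegaAlgebra.op k δ (fun i => Word.eval φ (u i))
  | .varMul x v => φ x * Word.eval φ v
  | .opMul δ u v => OmegaAlgebra.op k δ (fun i => Word.eval φ (u i)) * Word.eval φ v

theorem Word.eval_mul (φ : X → A) (s t : Word Ω X) :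
    Word.eval k φ (s * t) = Word.eval k φ s * Word.eval k φ t := by
  change Word.eval k φ (Word.mul s t) = _
  induction s with
  | var x => rfl
  | op δ u _ => rfl
  | varMul x v ih => simp only [Word.mul, Word.eval, ih, mul_assoc]
  | opMul δ u v _ ih => simp only [Word.mul, Word.eval, ih, mul_assoc]

variable [IsScalarTower k A A] [SMulCommClass k A A]

/-- The multiplicative linear extension of `Word.eval`. -/
noncomputable def Free.evalHom (φ : X → A) : Free k Ω X →ₙₐ[k] A :=
  MonoidAlgebra.liftMagma k ⟨Word.eval k φ, Word.eval_mul φ⟩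

theorem Free.evalHom_single (φ : X → A) (s : Word Ω X) :
    Free.evalHom φ (MonoidAlgebra.single s 1 : Free k Ω X) = Word.eval k φ s := by
  simp [Free.evalHom]

/-- The homomorphism from the free `Ω`-algebra extending a given map on the letters. -/
noncomputable def Free.lift (φ : X → A) : Hom k Ω (Free k Ω X) A where
  toNonUnitalAlgHom := Free.evalHom φ
  map_op' {n} δ a := by
    -- Both sides are multilinear, so they need only be compared on tuples of words.
    have h : ((Free.evalHom φ : Free k Ω X →ₙₐ[k] A) : Free k Ω X →ₗ[k] A).compMultilinearMap (op k δ)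
        = (op k δ).compLinearMap
          (fun _ => ((Free.evalHom φ : Free k Ω X →ₙₐ[k] A) : Free k Ω X →ₗ[k] A)) := by
      refine Module.Basis.ext_multilinear (fun _ => MonoidAlgebra.basis (Word Ω X) k) fun u => ?_
      have : ∀ s, MonoidAlgebra.basis (Word Ω X) k s = MonoidAlgebra.single s 1 := by
        intro s; simp
      simp only [this, LinearMap.compMultilinearMap_apply, MultilinearMap.compLinearMap_apply,
        Free.op_single]
      erw [Free.evalHom_single]
      simp only [Word.eval]
      congr 1; funext i
      exact (Free.evalHom_single φ (u i)).symm
    exact congrArg (fun f => f a) h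

@[simp] theorem Free.lift_of (φ : X → A) (x : X) :
    Free.lift φ (Free.of k Ω x) = φ x :=
  Free.evalHom_single φ (.var x)

/-- Homomorphisms on the free `Ω`-algebra are determined by their values on the letters. -/
theorem Free.hom_ext {B : Type*} [NonUnitalRing B] [Module k B] [OmegaAlgebra k Ω B]
    {f g : Hom k Ω (Free k Ω X) B}
    (h : ∀ x, f (Free.of k Ω x) = g (Free.of k Ω x)) (a : Free k Ω X) : f a = g a := by
  have hw : ∀ s : Word Ω X, f (MonoidAlgebra.single s 1) = g (MonoidAlgebra.single s 1) := by
    have hmul : ∀ s t : Word Ω X, (MonoidAlgebra.single (s * t) 1 : Free k Ω X)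
        = MonoidAlgebra.single s 1 * MonoidAlgebra.single t 1 := fun s t => by
      rw [MonoidAlgebra.single_mul_single, one_mul]
    have hop : ∀ {n : ℕ+} (δ : Ω n) (u : Fin (n : ℕ) → Word Ω X),
        (∀ i, f (MonoidAlgebra.single (u i) 1) = g (MonoidAlgebra.single (u i) 1)) →
        f (MonoidAlgebra.single (.op δ u) 1) = g (MonoidAlgebra.single (.op δ u) 1) := by
      intro n δ u hu
      rw [← Free.op_single, f.map_op, g.map_op]
      simp only [hu]
    intro s
    induction s with
    | var x => exact h x
    | op δ u hu => exact hop δ u hu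
    | varMul x v ih =>
      change f (MonoidAlgebra.single (.var x * v) 1) = g (MonoidAlgebra.single (.var x * v) 1)
      rw [hmul, map_mul, map_mul, ih]
      exact congrArg (· * _) (h x)
    | opMul δ u v hu ih =>
      change f (MonoidAlgebra.single (.op δ u * v) 1) = g (MonoidAlgebra.single (.op δ u * v) 1)
      rw [hmul, map_mul, map_mul, ih, hop δ u hu]
  have hl : (f.toNonUnitalAlgHom : Free k Ω X →ₗ[k] B) = g.toNonUnitalAlgHom :=
    (MonoidAlgebra.basis (Word Ω X) k).ext fun s => by
      simpa using hw s
  exact congrArg (fun l => l a) hl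

end FreeLift

/-! ### An algebra in which the equations are solvable -/

section Envelope

variable {k : Type*} [Field k] {Ω : ℕ+ → Type*} (A : Type*) [NonUnitalRing A] [Module k A]
  [IsScalarTower k A A] [SMulCommClass k A A]

/-- For a `k`-algebra `W` acting on itself from the left, all equations `x ∘ f ∘ y = g`, with `f ≠ 0`
the action of an element of `W` on a direct sum of copies of `W` indexed by lists, are solvable. -/
theorem exists_mul_lsmul_mul {k : Type*} [Field k] {W S : Type*} [Ring W] [Algebra k W]
    (b : Module.Basis S k W) {f : W} (hf : f ≠ 0) (g : Module.End k (List S →₀ W)) :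
    ∃ x y : Module.End k (List S →₀ W), x * Algebra.lsmul k k (List S →₀ W) f * y = g := by
  obtain ⟨p, hp⟩ : ∃ p : W →ₗ[k] k, p f = 1 := by
    obtain ⟨p, hp⟩ := (LinearMap.toSpanSingleton k W f).exists_leftInverse_of_injective
      (LinearMap.ker_toSpanSingleton k hf)
    exact ⟨p, by simpa using congrArg (fun l => l 1) hp⟩
  -- The map `y` sends the basis vector `b s` of copy `l` to the unit of copy `s :: l`, and `f`
  -- turns this unit into `f`. Then `x` reads off `p f = 1` and, knowing `s` and `l` from the list,
  -- returns the value of `g` on the original vector. Copy `[]` is never hit by `y`, so `x` may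
  -- vanish there.
  refine ⟨Finsupp.lsum k fun
      | [] => 0
      | s :: l => p.smulRight (g (Finsupp.single l (b s))),
    Finsupp.lsum k fun l => b.constr k fun s => Finsupp.single (s :: l) (1 : W), ?_⟩
  refine Finsupp.lhom_ext' fun l => b.ext fun s => ?_
  simp [hp]

variable (k) in
/-- The faithful representation of a `k`-algebra on a direct sum of copies of its unitization. -/
noncomputable def regularRep (J : Type*) : A →ₙₐ[k] Module.End k (J →₀ Unitization k A) :=
  ((Algebra.lsmul k k (J →₀ Unitization k A) :
      Unitization k A →ₐ[k] Module.End k (J →₀ Unitization k A)) :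
        Unitization k A →ₙₐ[k] Module.End k (J →₀ Unitization k A)).comp
    (Unitization.inrNonUnitalAlgHom k A)

variable [OmegaAlgebra k Ω A]

omit [IsScalarTower k A A] [SMulCommClass k A A] in
variable {A} in
/-- The operations of `A` extend along an injective homomorphism of `k`-algebras. -/
theorem exists_omegaAlgebra_extension {E : Type*} [NonUnitalRing E] [Module k E] (r : A →ₙₐ[k] E)
    (hr : Function.Injective r) :
    ∃ (_ : OmegaAlgebra k Ω E) (ι : Hom k Ω A E), ∀ a, ι a = r a := by
  obtain ⟨p, hp⟩ := LinearMap.exists_leftInverse_of_injective (r : A →ₗ[k] E)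
    (LinearMap.ker_eq_bot.2 hr)
  have hp' : ∀ a, p (r a) = a := fun a => congrArg (fun l => l a) hp
  let _ : OmegaAlgebra k Ω E :=
    ⟨fun δ => (r : A →ₗ[k] E).compMultilinearMap ((op k δ).compLinearMap fun _ => p)⟩
  refine ⟨inferInstance,
    { toNonUnitalAlgHom := r
      map_op' := fun δ a => ?_ }, fun _ => rfl⟩
  change r (op k δ a) = r (op k δ fun i => p (r (a i)))
  simp only [hp']

/-- Every `Ω`-algebra embeds into an `Ω`-algebra in which `x f y = g` is solvable for all elements
`f ≠ 0` and `g` of the original one. -/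
theorem exists_envelope (k : Type v) [Field k] (Ω : ℕ+ → Type w) (A : Type u) [NonUnitalRing A]
    [Module k A] [IsScalarTower k A A] [SMulCommClass k A A] [OmegaAlgebra k Ω A] :
    ∃ (E : Type (max u v)) (_ : NonUnitalRing E) (_ : Module k E) (_ : IsScalarTower k E E)
      (_ : SMulCommClass k E E) (_ : OmegaAlgebra k Ω E) (ι : Hom k Ω A E),
      Function.Injective ι ∧ ∀ f g : A, f ≠ 0 → ∃ x y : E, x * ι f * y = ι g := by
  let b := Module.Basis.ofVectorSpace k (Unitization k A)
  have hr : ∀ f g, f ≠ 0 → ∃ x y, x * regularRep k A (List _) f * y = g := fun f g hf =>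
    exists_mul_lsmul_mul b (f := (f : Unitization k A))
      (fun h => hf (Unitization.inr_injective (h.trans (Unitization.inr_zero k).symm))) g
  -- From here on only solvability matters; even injectivity follows from it, by taking the
  -- right-hand side `1`.
  generalize regularRep k A _ = r at hr
  have hinj : Function.Injective r := by
    refine (injective_iff_map_eq_zero r).2 fun f hf => ?_
    by_contra h
    obtain ⟨x, y, hxy⟩ := hr f 1 h
    rw [hf, mul_zero, zero_mul] at hxy
    exact zero_ne_one hxy
  obtain ⟨_, ι, hι⟩ := exists_omegaAlgebra_extension (Ω := Ω)
    (E := Module.End k (List (Module.Basis.ofVectorSpaceIndex k (Unitization k A)) →₀ Unitization k A))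
    r hinj
  refine ⟨_, inferInstance, inferInstance, inferInstance, inferInstance, inferInstance, ι,
    fun a c h => hinj ?_, fun f g hf => ?_⟩
  · rwa [hι, hι] at h
  · rw [hι, hι]
    exact hr f (r g) hf

end Envelope

/-! ### The relations of a step -/

section Step

variable {k : Type*} [Field k] {Ω : ℕ+ → Type*}

/-- A linear map that is compatible with products and operations of basis elements is a
homomorphism. -/
noncomputable def Hom.ofBasis {A D I : Type*}
    [NonUnitalRing A] [Module k A] [IsScalarTower k A A] [SMulCommClass k A A] [OmegaAlgebra k Ω A]
    [NonUnitalRing D] [Module k D] [IsScalarTower k D D] [SMulCommClass k D D] [OmegaAlgebra k Ω D]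
    (b : Module.Basis I k A) (l : A →ₗ[k] D) (hmul : ∀ i j, l (b i * b j) = l (b i) * l (b j))
    (hop : ∀ {n : ℕ+} (δ : Ω n) (c : Fin (n : ℕ) → I),
      l (op k δ fun m => b (c m)) = op k δ fun m => l (b (c m))) : Hom k Ω A D where
  toFun := l
  map_smul' := l.map_smul
  map_zero' := l.map_zero
  map_add' := l.map_add
  map_mul' x y := by
    have h : (LinearMap.mul k A).compr₂ l = (LinearMap.mul k D).compl₁₂ l l :=
      b.ext fun i => b.ext fun j => hmul i j
    exact congrArg (fun m => m x y) h
  map_op' δ a := by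
    have h : l.compMultilinearMap (op k δ) = (op k δ).compLinearMap fun _ => l :=
      Module.Basis.ext_multilinear (fun _ => b) fun c => hop δ c
    exact congrArg (fun m => m a) h

variable {A : Type*} [NonUnitalRing A] [Module k A] {I : Type*} [LinearOrder I]

/-- A nonzero element is a nonzero multiple of a monic one. -/
theorem exists_smul_monic (b : Module.Basis I k A) {a : A} (ha : a ≠ 0) :
    ∃ (c : k) (f : Monic b), a = c • f.1 ∧ c ≠ 0 := by
  have hs : (b.repr a).support.Nonempty := by simpa [Finsupp.support_nonempty_iff] using ha
  let i := (b.repr a).support.max' hs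
  have hi : b.repr a i ≠ 0 := Finsupp.mem_support_iff.1 (Finset.max'_mem _ hs)
  refine ⟨b.repr a i, ⟨(b.repr a i)⁻¹ • a, i, by simp [hi], fun j hj => ?_⟩, by simp [hi], hi⟩
  have : b.repr a j = 0 := by
    by_contra h
    exact absurd (Finset.le_max' _ j (Finsupp.mem_support_iff.2 h)) (not_le.2 hj)
  simp [this]

variable [OmegaAlgebra k Ω A]

omit [OmegaAlgebra k Ω A] in
theorem stepLift_basis (b : Module.Basis I k A) (i : I) :
    stepLift Ω b (b i) = Free.of k Ω (.base i) :=
  b.constr_basis k _ i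

omit [OmegaAlgebra k Ω A] in
theorem Hom.apply_stepLift {D : Type*} [NonUnitalRing D] [Module k D] [OmegaAlgebra k Ω D]
    {b : Module.Basis I k A} {g : Hom k Ω (Free k Ω (StepLetter I (Monic b))) D} {l : A →ₗ[k] D}
    (h : ∀ i, g (Free.of k Ω (.base i)) = l (b i)) (a : A) : g (stepLift Ω b a) = l a := by
  have : (g.toNonUnitalAlgHom : _ →ₗ[k] D) ∘ₗ stepLift Ω b = l :=
    b.ext fun i => (congrArg g (stepLift_basis b i)).trans (h i)
  exact congrArg (fun m => m a) this

/-- The relations of a step hold as soon as the letters `xᵢ` are mapped in accordance with a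
homomorphism and the equations `x_{θσ} f_θ y_{θσ} = f_σ` are satisfied. -/
theorem Hom.apply_stepRelations {D : Type*} [NonUnitalRing D] [Module k D] [OmegaAlgebra k Ω D]
    {b : Module.Basis I k A} {g : Hom k Ω (Free k Ω (StepLetter I (Monic b))) D} (h : Hom k Ω A D)
    (hb : ∀ i, g (Free.of k Ω (.base i)) = h (b i))
    (hm : ∀ θ σ, g (Free.of k Ω (.left θ σ)) * h θ.1 * g (Free.of k Ω (.right θ σ)) = h σ.1)
    {s} (hs : s ∈ stepRelations (Ω := Ω) b) : g s = 0 := by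
  have hl : ∀ a, g (stepLift Ω b a) = h a :=
    Hom.apply_stepLift (l := (h.toNonUnitalAlgHom : A →ₗ[k] D)) hb
  rcases hs with (⟨i, j, rfl⟩ | ⟨n, δ, c, rfl⟩) | ⟨θ, σ, rfl⟩
  · rw [map_sub, map_mul, hb, hb, hl, map_mul, sub_self]
  · rw [map_sub, g.map_op, hl, h.map_op]
    simp only [hb, sub_self]
  · rw [map_sub, map_mul, map_mul, hl, hl, hm, sub_self]

/-- A homomorphism on the free `Ω`-algebra that satisfies the relations of a step restricts to a
homomorphism on `A`. -/
noncomputable def Hom.ofStepRelations [IsScalarTower k A A] [SMulCommClass k A A] {D : Type*}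
    [NonUnitalRing D] [Module k D] [IsScalarTower k D D] [SMulCommClass k D D] [OmegaAlgebra k Ω D]
    {b : Module.Basis I k A} (g : Hom k Ω (Free k Ω (StepLetter I (Monic b))) D)
    (hg : ∀ s ∈ stepRelations (Ω := Ω) b, g s = 0) : Hom k Ω A D :=
  Hom.ofBasis b
    ((g.toNonUnitalAlgHom : Free k Ω (StepLetter I (Monic b)) →ₗ[k] D) ∘ₗ stepLift Ω b)
    (fun i j => by
      change g (stepLift Ω b (b i * b j)) = g (stepLift Ω b (b i)) * g (stepLift Ω b (b j))
      have h := hg _ (.inl (.inl ⟨i, j, rfl⟩))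
      rw [map_sub, sub_eq_zero, map_mul] at h
      rw [stepLift_basis b i, stepLift_basis b j, h])
    (fun {n} δ c => by
      change g (stepLift Ω b (op k δ fun m => b (c m))) = op k δ fun m => g (stepLift Ω b (b (c m)))
      have h := hg _ (.inl (.inr ⟨n, δ, c, rfl⟩))
      rw [map_sub, sub_eq_zero, g.map_op] at h
      simp only [stepLift_basis, h])

end Step

/-! ### Existence of injective steps and invariance under isomorphism -/

section IsStep

/-- Every `Ω`-algebra admits an injective step. -/
theorem exists_isStep {k : Type v} [Field k] {Ω : ℕ+ → Type w} (A : Type (max u v w))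
    [NonUnitalRing A] [Module k A] [IsScalarTower k A A] [SMulCommClass k A A]
    [OmegaAlgebra k Ω A] :
    ∃ (A' : Type (max u v w)) (_ : NonUnitalRing A') (_ : Module k A') (_ : IsScalarTower k A' A')
      (_ : SMulCommClass k A' A') (_ : OmegaAlgebra k Ω A') (j : Hom k Ω A A'),
      Function.Injective j ∧ IsStep j := by
  let I := Module.Basis.ofVectorSpaceIndex k A
  let b : Module.Basis I k A := Module.Basis.ofVectorSpace k A
  let _ : LinearOrder I := IsWellOrder.linearOrder WellOrderingRel
  have hwf : WellFoundedLT I := inferInstanceAs (IsWellFounded I WellOrderingRel)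
  let J := idealSpan k Ω (stepRelations (Ω := Ω) b)
  let q : Hom k Ω _ J.Quotient := Ideal.Quotient.mk J
  let j : Hom k Ω A J.Quotient := Hom.ofStepRelations q fun s hs =>
    (Ideal.Quotient.mk_eq_zero_iff J).2 (subset_idealSpan _ hs)
  refine ⟨J.Quotient, inferInstance, inferInstance, inferInstance, inferInstance, inferInstance,
    j, ?_, I, inferInstance, hwf, b, fun x => q (Free.of k Ω x), fun i => ?_, q, fun _ => rfl,
    Ideal.Quotient.mk_surjective J, fun f => Ideal.Quotient.mk_eq_zero_iff J⟩
  · obtain ⟨E, _, _, _, _, _, ι, hι, hE⟩ := exists_envelope k Ω A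
    have hne : ∀ θ : Monic b, θ.1 ≠ 0 := by
      rintro ⟨f, i, hi, -⟩ rfl
      simp at hi
    choose x y hxy using fun θ σ : Monic b => hE θ.1 σ.1 (hne θ)
    let φ : StepLetter I (Monic b) → E
      | .base i => ι (b i)
      | .left θ σ => x θ σ
      | .right θ σ => y θ σ
    have hφ : ∀ s ∈ stepRelations (Ω := Ω) b, Free.lift φ s ∈ (Ideal.zero (k := k) (Ω := Ω) E).toSubmodule :=
      fun s hs => Hom.apply_stepRelations ι (fun i => Free.lift_of φ _)
        (fun θ σ => by simp only [Free.lift_of]; exact hxy θ σ) hs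
    refine (injective_iff_map_eq_zero j.toNonUnitalAlgHom).2 fun a ha => ?_
    -- If `a` dies in the quotient, its lift lies in the ideal of relations, which is killed in `E`;
    -- but the lift is sent to `ι a` there.
    have h0 : Free.lift φ (stepLift Ω b a) = 0 :=
      idealSpan_map_mem (Free.lift φ) hφ ((Ideal.Quotient.mk_eq_zero_iff J).1 ha)
    rw [Hom.apply_stepLift (l := (ι.toNonUnitalAlgHom : A →ₗ[k] E)) fun i => Free.lift_of φ _] at h0
    exact hι (h0.trans (map_zero ι.toNonUnitalAlgHom).symm)
  · exact congrArg q (stepLift_basis b i).symm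

variable {k : Type*} [Field k] {Ω : ℕ+ → Type*} {A A' B B' : Type u}
  [NonUnitalRing A] [Module k A] [OmegaAlgebra k Ω A]
  [NonUnitalRing A'] [Module k A'] [OmegaAlgebra k Ω A']
  [NonUnitalRing B] [Module k B] [OmegaAlgebra k Ω B]
  [NonUnitalRing B'] [Module k B'] [OmegaAlgebra k Ω B']

theorem IsStep.exists_mul_mul_eq [IsScalarTower k A' A'] [SMulCommClass k A' A']
    {j : Hom k Ω A A'} (h : IsStep j) {f : A} (hf : f ≠ 0) (g : A) :
    ∃ x y, x * j f * y = j g := by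
  obtain ⟨I, _, _, b, φ, hφ, π, hπ, -, hker⟩ := h
  rcases eq_or_ne g 0 with rfl | hg
  · exact ⟨0, 0, by rw [zero_mul, zero_mul, map_zero]⟩
  obtain ⟨c, θ, rfl, hc⟩ := exists_smul_monic b hf
  obtain ⟨d, σ, rfl, -⟩ := exists_smul_monic b hg
  have hl : ∀ a, π (stepLift Ω b a) = j a :=
    Hom.apply_stepLift (l := (j.toNonUnitalAlgHom : A →ₗ[k] A')) fun i => (hπ _).trans (hφ i)
  have hrel := (hker _).2 (subset_idealSpan (k := k) _ (Or.inr ⟨θ, σ, rfl⟩))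
  rw [map_sub, map_mul, map_mul, hl, hl, hπ, hπ, sub_eq_zero] at hrel
  -- Here `f = c • f_θ` and `g = d • f_σ`, so the scalar cancels `c` and supplies `d`.
  refine ⟨(d * c⁻¹) • φ (.left θ σ), φ (.right θ σ), ?_⟩
  rw [map_smul, map_smul, ← hrel, smul_mul_smul_comm, smul_mul_assoc, mul_assoc d,
    inv_mul_cancel₀ hc, mul_one]

/-- The map on letters induced by a map of monic elements. -/
def StepLetter.map {I T T' : Type*} (m : T → T') : StepLetter I T → StepLetter I T'
  | .base i => .base i
  | .left θ σ => .left (m θ) (m σ)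
  | .right θ σ => .right (m θ) (m σ)

/-- The homomorphism of free `Ω`-algebras induced by a map of monic elements. -/
noncomputable def stepMap {I T T' : Type*} (k : Type*) [Field k] (Ω : ℕ+ → Type*) (m : T → T') :
    Hom k Ω (Free k Ω (StepLetter I T)) (Free k Ω (StepLetter I T')) :=
  Free.lift fun x => Free.of k Ω (x.map m)

theorem stepMap_stepMap {I T T' : Type*} {m : T → T'} {m' : T' → T} (h : ∀ t, m' (m t) = t)
    (a : Free k Ω (StepLetter I T)) : stepMap k Ω m' (stepMap k Ω m a) = a := by
  refine Free.hom_ext (f := (stepMap k Ω m').comp (stepMap k Ω m)) (g := Free.lift (Free.of k Ω))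
    (fun x => ?_) a |>.trans ?_
  · cases x <;> simp [stepMap, StepLetter.map, h]
  · exact Free.hom_ext (f := Free.lift (Free.of k Ω)) (g := ⟨NonUnitalAlgHom.id k _, fun _ _ => rfl⟩)
      (fun x => Free.lift_of _ x) a

/-- When `e` matches the bases and `m` the monic elements, each defining relation for `b` goes to
one for `c`. -/
theorem stepMap_mem {I : Type*} [LinearOrder I] {b : Module.Basis I k A} {c : Module.Basis I k B}
    (e : Hom k Ω A B) (he : ∀ i, e (b i) = c i) {m : Monic b → Monic c} (hm : ∀ f, (m f).1 = e f.1)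
    {s} (hs : s ∈ (idealSpan k Ω (stepRelations (Ω := Ω) b)).toSubmodule) :
    stepMap k Ω m s ∈ (idealSpan k Ω (stepRelations (Ω := Ω) c)).toSubmodule := by
  refine idealSpan_map_mem (stepMap k Ω m) (fun s hs => subset_idealSpan _ ?_) hs
  have hl : ∀ a, stepMap k Ω m (stepLift Ω b a) = stepLift Ω c (e a) :=
    Hom.apply_stepLift (l := stepLift Ω c ∘ₗ (e.toNonUnitalAlgHom : A →ₗ[k] B)) fun i =>
      (Free.lift_of _ _).trans ((stepLift_basis c i).symm.trans (congrArg _ (he i).symm))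
  have hof : ∀ x : StepLetter I (Monic b),
      stepMap k Ω m (Free.of k Ω x) = Free.of k Ω (x.map m) := fun x => Free.lift_of _ x
  rcases hs with (⟨i, j, rfl⟩ | ⟨n, δ, d, rfl⟩) | ⟨θ, σ, rfl⟩
  · refine .inl (.inl ⟨i, j, ?_⟩)
    rw [map_sub, map_mul, hof, hof, hl, map_mul, he, he]; rfl
  · refine .inl (.inr ⟨n, δ, d, ?_⟩)
    rw [map_sub, Hom.map_op, hl, Hom.map_op]
    simp only [hof, he]; rfl
  · refine .inr ⟨m θ, m σ, ?_⟩
    rw [map_sub, map_mul, map_mul, hof, hof, hl, hl, ← hm, ← hm]; rfl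

/-- Being a step is invariant under isomorphism. -/
theorem IsStep.of_bijective {j : Hom k Ω A A'} (h : IsStep j) {j' : Hom k Ω B B'}
    {e : Hom k Ω A B} (he : Function.Bijective e) {e' : Hom k Ω A' B'}
    (he' : Function.Bijective e') (hj : ∀ a, j' (e a) = e' (j a)) : IsStep j' := by
  obtain ⟨I, _, _, b, φ, hφ, π, hπ, hsurj, hker⟩ := h
  let l : A ≃ₗ[k] B := LinearEquiv.ofBijective (e.toNonUnitalAlgHom : A →ₗ[k] B) he
  let c : Module.Basis I k B := b.map l
  have hb : ∀ i, e (b i) = c i := fun i => (b.map_apply l i).symm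
  have hl : ∀ a, l.symm a = e.inverse he a := fun a => he.1 <| by
    rw [e.apply_inverse]; exact l.apply_symm_apply a
  have hr : ∀ a, c.repr a = b.repr (e.inverse he a) := fun a => by
    rw [← hl]; rfl
  -- Being monic depends only on coordinates, and `e` preserves these because `c` is the image of
  -- `b` with the same ordered index set.
  let m : Monic b → Monic c := fun f => ⟨e f.1, by simpa only [hr, e.inverse_apply] using f.2⟩
  let m' : Monic c → Monic b := fun f => ⟨e.inverse he f.1, by simpa only [hr] using f.2⟩
  have hm' : ∀ f, m' (m f) = f := fun f => Subtype.ext (e.inverse_apply he _)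
  have hm : ∀ f, m (m' f) = f := fun f => Subtype.ext (e.apply_inverse he _)
  refine ⟨I, inferInstance, inferInstance, c, fun x => e' (φ (x.map m')), fun i => ?_,
    e'.comp (π.comp (stepMap k Ω m')), fun x => ?_, ?_, fun f => ?_⟩
  · rw [← hb, hj, ← hφ]; rfl
  · simp only [Hom.comp_apply, stepMap, Free.lift_of, hπ]
  · intro y
    obtain ⟨y, rfl⟩ := he'.2 y
    obtain ⟨y, rfl⟩ := hsurj y
    exact ⟨stepMap k Ω m y, by simp only [Hom.comp_apply, stepMap_stepMap hm']⟩
  · have h0 : e'.comp (π.comp (stepMap k Ω m')) f = 0 ↔ π (stepMap k Ω m' f) = 0 :=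
      map_eq_zero_iff e'.toNonUnitalAlgHom he'.1
    rw [h0, hker]
    refine ⟨fun h => ?_, fun h => stepMap_mem (e.inverse he) (fun i => ?_) (fun _ => rfl) h⟩
    · have := stepMap_mem e hb (m := m) (fun _ => rfl) h
      rwa [stepMap_stepMap hm] at this
    · rw [← hb, e.inverse_apply]

end IsStep

/-! ### The union of a chain, as eventually compatible sequences modulo eventually zero ones -/

section Colimit

variable {k : Type*} [Field k] {Ω : ℕ+ → Type*}

instance {A : ℕ → Type*} [∀ n, NonUnitalRing (A n)] [∀ n, Module k (A n)]
    [∀ n, OmegaAlgebra k Ω (A n)] : OmegaAlgebra k Ω (∀ n, A n) where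
  opMap δ := MultilinearMap.pi fun n => (op k δ).compLinearMap fun _ => LinearMap.proj n

/-- The sequences that are, from the index `n` on, compatible with the maps `j`. -/
def IsCoherentFrom {A : ℕ → Type*} (j : ∀ n, A n → A (n + 1)) (n : ℕ) (s : ∀ n, A n) : Prop :=
  ∀ m, n ≤ m → s (m + 1) = j m (s m)

theorem IsCoherentFrom.mono {A : ℕ → Type*} {j : ∀ n, A n → A (n + 1)} {n m : ℕ} {s : ∀ n, A n}
    (h : IsCoherentFrom j n s) (hnm : n ≤ m) : IsCoherentFrom j m s :=
  fun l hl => h l (hnm.trans hl)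

theorem IsCoherentFrom.eq {A : ℕ → Type*} {j : ∀ n, A n → A (n + 1)} {n : ℕ} {s t : ∀ n, A n}
    (hs : IsCoherentFrom j n s) (ht : IsCoherentFrom j n t) (h : s n = t n) (m : ℕ) (hm : n ≤ m) :
    s m = t m := by
  induction m, hm using Nat.le_induction with
  | base => exact h
  | succ m hm ih => rw [hs m hm, ht m hm, ih]

/-- Entries past `n` are forced by iterating `j`, those before `n` are arbitrary; the induction
shifts the whole sequence of algebras by one. -/
theorem exists_isCoherentFrom {A : ℕ → Type*} [∀ n, Nonempty (A n)] (j : ∀ n, A n → A (n + 1))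
    (n : ℕ) (a : A n) : ∃ s, IsCoherentFrom j n s ∧ s n = a := by
  induction n generalizing A with
  | zero => exact ⟨fun m => Nat.rec a (fun m x => j m x) m, fun m _ => rfl, rfl⟩
  | succ n ih =>
    obtain ⟨s, hs, rfl⟩ := ih (A := fun m => A (m + 1)) (fun m => j (m + 1)) a
    refine ⟨fun m => Nat.casesOn m (Classical.arbitrary (A 0)) s, fun m hm => ?_, rfl⟩
    cases m with
    | zero => omega
    | succ m => exact hs m (by omega)

variable {A : ℕ → Type*} [∀ n, NonUnitalRing (A n)] [∀ n, Module k (A n)]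
  [∀ n, OmegaAlgebra k Ω (A n)] (j : ∀ n, Hom k Ω (A n) (A (n + 1)))

/-- The `Ω`-algebra of the eventually compatible sequences. -/
def coherentSubalg : Subalg k Ω (∀ n, A n) where
  carrier := {s | ∃ n, IsCoherentFrom (fun n => j n) n s}
  add_mem' := by
    rintro s t ⟨n, hs⟩ ⟨m, ht⟩
    refine ⟨max n m, fun l hl => ?_⟩
    simp [hs l (le_of_max_le_left hl), ht l (le_of_max_le_right hl)]
  zero_mem' := ⟨0, fun m _ => by simp⟩
  mul_mem' := by
    rintro s t ⟨n, hs⟩ ⟨m, ht⟩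
    refine ⟨max n m, fun l hl => ?_⟩
    simp [hs l (le_of_max_le_left hl), ht l (le_of_max_le_right hl)]
  smul_mem' := by
    rintro c s ⟨n, hs⟩
    exact ⟨n, fun l hl => by simp [hs l hl]⟩
  op_mem' δ s hs := by
    choose n hn using hs
    -- An operation has finitely many arguments, so they share an index from which all are
    -- compatible.
    refine ⟨Finset.univ.sup n, fun m hm => ?_⟩
    refine .trans ?_ ((j m).map_op δ fun i => s i m).symm
    change op k δ (fun i => s i (m + 1)) = _
    congr 1; funext i
    exact hn i m ((Finset.le_sup (Finset.mem_univ i)).trans hm)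

/-- The ideal of the eventually vanishing sequences. -/
def eventuallyZero : Ideal k Ω (coherentSubalg j).toNonUnitalSubalgebra where
  carrier := {s | ∃ n, ∀ m, n ≤ m → s.1 m = 0}
  add_mem' := by
    rintro s t ⟨n, hs⟩ ⟨m, ht⟩
    refine ⟨max n m, fun l hl => ?_⟩
    simp [hs l (le_of_max_le_left hl), ht l (le_of_max_le_right hl)]
  zero_mem' := ⟨0, fun _ _ => rfl⟩
  smul_mem' := by
    rintro c s ⟨n, hs⟩
    exact ⟨n, fun l hl => by simp [hs l hl]⟩
  mul_left_mem' := by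
    rintro t s ⟨n, hs⟩
    exact ⟨n, fun l hl => by simp [hs l hl]⟩
  mul_right_mem' := by
    rintro t s ⟨n, hs⟩
    exact ⟨n, fun l hl => by simp [hs l hl]⟩
  op_mem' := by
    rintro n δ s i ⟨n, hs⟩
    exact ⟨n, fun l hl => (op k δ).map_coord_zero (m := fun i => (s i).1 l) i (hs l hl)⟩

/-- A chain of injective homomorphisms has a colimit. -/
theorem exists_colimit {k : Type v} [Field k] {Ω : ℕ+ → Type w} {A : ℕ → Type u}
    [∀ n, NonUnitalRing (A n)] [∀ n, Module k (A n)]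
    [∀ n, IsScalarTower k (A n) (A n)] [∀ n, SMulCommClass k (A n) (A n)]
    [∀ n, OmegaAlgebra k Ω (A n)]
    (j : ∀ n, Hom k Ω (A n) (A (n + 1))) (hj : ∀ n, Function.Injective (j n)) :
    ∃ (B : Type u) (_ : NonUnitalRing B) (_ : Module k B) (_ : IsScalarTower k B B)
      (_ : SMulCommClass k B B) (_ : OmegaAlgebra k Ω B) (ι : ∀ n, Hom k Ω (A n) B),
      (∀ n, Function.Injective (ι n)) ∧ (∀ n a, ι (n + 1) (j n a) = ι n a) ∧
        ∀ b, ∃ n a, ι n a = b := by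
  choose s hs hsn using fun n => exists_isCoherentFrom (A := A) (fun n => j n) n
  let P := (coherentSubalg j).toNonUnitalSubalgebra
  let J := eventuallyZero j
  -- The chosen extensions `s n` need not be additive or multiplicative in the entries before `n`.
  -- Classes depend only on the entry at `n`, so the maps into the quotient are homomorphisms all
  -- the same.
  have hJ : ∀ (n : ℕ) (p q : P), IsCoherentFrom (fun n => j n) n p.1 →
      IsCoherentFrom (fun n => j n) n q.1 → p.1 n = q.1 n →
      Ideal.Quotient.mk J p = Ideal.Quotient.mk J q := fun n p q hp hq h =>
    (Ideal.Quotient.mk_eq_iff J).2 ⟨n, fun m hm => sub_eq_zero.2 (hp.eq hq h m hm)⟩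
  let σ : ∀ n, A n → P := fun n a => ⟨s n a, n, hs n a⟩
  have hadd : ∀ n (p q : P), IsCoherentFrom (fun n => j n) n p.1 →
      IsCoherentFrom (fun n => j n) n q.1 → IsCoherentFrom (fun n => j n) n (p + q).1 :=
    fun n p q hp hq m hm => by
      simp [hp m hm, hq m hm]
  have hmul : ∀ n (p q : P), IsCoherentFrom (fun n => j n) n p.1 →
      IsCoherentFrom (fun n => j n) n q.1 → IsCoherentFrom (fun n => j n) n (p * q).1 :=
    fun n p q hp hq m hm => by
      simp [hp m hm, hq m hm]
  have hsmul : ∀ n (c : k) (p : P), IsCoherentFrom (fun n => j n) n p.1 →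
      IsCoherentFrom (fun n => j n) n (c • p).1 :=
    fun n c p hp m hm => by
      simp [hp m hm]
  have hzero : ∀ n, IsCoherentFrom (fun n => j n) n (0 : P).1 := fun n m hm => by simp
  let ι : ∀ n, Hom k Ω (A n) J.Quotient := fun n =>
    { toFun := fun a => Ideal.Quotient.mk J (σ n a)
      map_smul' := fun c a => by
        refine (hJ n _ (c • σ n a) (hs n _) (hsmul n c _ (hs n _)) ?_).trans
          (map_smul (Ideal.Quotient.mk J).toNonUnitalAlgHom c _)
        refine (hsn n _).trans ?_
        change c • a = c • s n a n
        rw [hsn]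
      map_zero' := by
        refine (hJ n _ 0 (hs n _) (hzero n) ?_).trans
          (map_zero (Ideal.Quotient.mk J).toNonUnitalAlgHom)
        exact hsn n 0
      map_add' := fun a b => by
        refine (hJ n _ (σ n a + σ n b) (hs n _) (hadd n _ _ (hs n _) (hs n _)) ?_).trans
          (map_add (Ideal.Quotient.mk J).toNonUnitalAlgHom _ _)
        refine (hsn n _).trans ?_
        change a + b = s n a n + s n b n
        rw [hsn, hsn]
      map_mul' := fun a b => by
        refine (hJ n _ (σ n a * σ n b) (hs n _) (hmul n _ _ (hs n _) (hs n _)) ?_).trans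
          (map_mul (Ideal.Quotient.mk J).toNonUnitalAlgHom _ _)
        refine (hsn n _).trans ?_
        change a * b = s n a n * s n b n
        rw [hsn, hsn]
      map_op' := fun δ a => by
        refine (hJ n _ (op k δ fun i => σ n (a i)) (hs n _) (fun m hm => ?_) ?_).trans
          ((Ideal.Quotient.mk J).map_op δ _)
        · refine .trans ?_ ((j m).map_op δ fun i => s n (a i) m).symm
          change op k δ (fun i => s n (a i) (m + 1)) = _
          congr 1; funext i
          exact hs n (a i) m hm
        · refine (hsn n _).trans ?_
          change op k δ a = op k δ fun i => s n (a i) n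
          simp only [hsn] }
  refine ⟨J.Quotient, inferInstance, inferInstance, inferInstance, inferInstance, inferInstance, ι,
    fun n => ?_, fun n a => ?_, fun b => ?_⟩
  · refine (injective_iff_map_eq_zero (ι n).toNonUnitalAlgHom).2 fun a ha => ?_
    obtain ⟨m, hm⟩ := (Ideal.Quotient.mk_eq_zero_iff J).1 ha
    -- Injectivity of the maps `j` carries vanishing at a late index back to index `n`.
    have : ∀ d, s n a (n + d) = 0 → s n a n = 0 := by
      intro d
      induction d with
      | zero => exact id
      | succ d ih =>
        intro h
        refine ih (hj (n + d) ?_)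
        rw [map_zero, ← h]
        exact (hs n a (n + d) (Nat.le_add_right n d)).symm
    rw [← hsn n a]
    exact this m (hm (n + m) (Nat.le_add_left m n))
  · refine hJ (n + 1) _ _ (hs _ _) ((hs n a).mono n.le_succ) ?_
    refine (hsn _ _).trans ?_
    change _ = s n a (n + 1)
    rw [hs n a n le_rfl, hsn]
  · obtain ⟨⟨p, n, hp⟩, rfl⟩ := Ideal.Quotient.mk_surjective J b
    exact ⟨n, p n, hJ n _ _ (hs _ _) hp (hsn _ _)⟩

end Colimit

/-! ### Iterating the step, and simplicity of the union -/

section Chain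

/-- An `Ω`-algebra, bundled with its carrier. -/
structure Bundled (k : Type v) [Field k] (Ω : ℕ+ → Type w) where
  carrier : Type (max u v w)
  [ring : NonUnitalRing carrier]
  [module : Module k carrier]
  [isScalarTower : IsScalarTower k carrier carrier]
  [smulCommClass : SMulCommClass k carrier carrier]
  [omegaAlgebra : OmegaAlgebra k Ω carrier]

attribute [instance] Bundled.ring Bundled.module Bundled.isScalarTower Bundled.smulCommClass
  Bundled.omegaAlgebra

/-- Bundling lets the recursion choose each carrier together with its structure. Carriers live in a
universe that also holds `k` and `Ω`, so that a step does not leave it. -/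
theorem exists_chain {k : Type v} [Field k] {Ω : ℕ+ → Type w} (A : Bundled.{u} k Ω) :
    ∃ (C : ℕ → Bundled.{u} k Ω) (j : ∀ n, Hom k Ω (C n).carrier (C (n + 1)).carrier),
      C 0 = A ∧ ∀ n, Function.Injective (j n) ∧ IsStep (j n) := by
  have h : ∀ A : Bundled.{u} k Ω, ∃ (A' : Bundled.{u} k Ω) (j : Hom k Ω A.carrier A'.carrier),
      Function.Injective j ∧ IsStep j := fun A => by
    obtain ⟨A', _, _, _, _, _, j, hj⟩ := exists_isStep.{u} (k := k) (Ω := Ω) A.carrier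
    exact ⟨⟨A'⟩, j, hj⟩
  choose next j hj using h
  exact ⟨fun n => Nat.rec A (fun _ => next) n, fun n => j _, rfl, fun n => hj _⟩

/-- The colimit of a chain of steps that starts with a nonzero algebra is simple. -/
theorem isSimple_of_chain {k : Type*} [Field k] {Ω : ℕ+ → Type*} {A : ℕ → Type u}
    [∀ n, NonUnitalRing (A n)] [∀ n, Module k (A n)]
    [∀ n, IsScalarTower k (A n) (A n)] [∀ n, SMulCommClass k (A n) (A n)]
    [∀ n, OmegaAlgebra k Ω (A n)] {j : ∀ n, Hom k Ω (A n) (A (n + 1))}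
    (hj : ∀ n, IsStep (j n)) {B : Type*} [NonUnitalRing B] [Module k B] [OmegaAlgebra k Ω B]
    {ι : ∀ n, Hom k Ω (A n) B} (hinj : ∀ n, Function.Injective (ι n))
    (hι : ∀ n a, ι (n + 1) (j n a) = ι n a) (hsurj : ∀ b, ∃ n a, ι n a = b) [Nontrivial (A 0)] :
    IsSimple k Ω B := by
  have hmono : ∀ n m a, n ≤ m → ∃ a', ι m a' = ι n a := by
    intro n m a hnm
    induction m, hnm using Nat.le_induction with
    | base => exact ⟨a, rfl⟩
    | succ m _ ih =>
      obtain ⟨a', ha'⟩ := ih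
      exact ⟨j m a', (hι m a').trans ha'⟩
  have hsolve : ∀ f g : B, f ≠ 0 → ∃ x y, x * f * y = g := by
    intro f g hf
    obtain ⟨n, f, rfl⟩ := hsurj f
    obtain ⟨m, g, rfl⟩ := hsurj g
    obtain ⟨f', hf'⟩ := hmono n (max n m) f (le_max_left n m)
    obtain ⟨g', hg'⟩ := hmono m (max n m) g (le_max_right n m)
    rw [← hf'] at hf ⊢
    rw [← hg']
    obtain ⟨x, y, hxy⟩ := (hj (max n m)).exists_mul_mul_eq (f := f')
      (fun h => hf (by rw [h, map_zero])) g'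
    exact ⟨ι _ x, ι _ y, by rw [← hι _ f', ← hι _ g', ← hxy, map_mul, map_mul]⟩
  constructor
  · obtain ⟨a, ha⟩ := exists_ne (0 : A 0)
    have ha' : ι 0 a ≠ 0 := fun h => ha (hinj 0 (h.trans (map_zero _).symm))
    obtain ⟨x, y, hxy⟩ := hsolve _ (ι 0 a) ha'
    exact ⟨_, _, fun h => ha' (hxy.symm.trans h)⟩
  · intro J
    refine or_iff_not_imp_left.2 fun hJ => ?_
    obtain ⟨f, hf, hf0⟩ := J.toSubmodule.ne_bot_iff.1 hJ
    refine eq_top_iff.2 fun g _ => ?_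
    obtain ⟨x, y, rfl⟩ := hsolve f g hf0
    exact J.mul_right_mem' y (J.mul_left_mem' x hf)

instance {k : Type v} [Field k] {Ω : ℕ+ → Type w} {A : Type u} [NonUnitalRing A] [Module k A]
    [OmegaAlgebra k Ω A] : OmegaAlgebra k Ω (ULift.{max v w} A) where
  opMap δ := (ULift.moduleEquiv.symm : A ≃ₗ[k] ULift A).toLinearMap.compMultilinearMap
    ((op k δ).compLinearMap fun _ => (ULift.moduleEquiv : ULift A ≃ₗ[k] A).toLinearMap)

/-- The embedding of an `Ω`-algebra into its copy in a larger universe. -/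
def Hom.up (k : Type v) [Field k] (Ω : ℕ+ → Type w) (A : Type u) [NonUnitalRing A] [Module k A]
    [OmegaAlgebra k Ω A] : Hom k Ω A (ULift.{max v w} A) where
  toFun := ULift.up
  map_smul' _ _ := rfl
  map_zero' := rfl
  map_add' _ _ := rfl
  map_mul' _ _ := rfl
  map_op' _ _ := rfl

theorem exists_simple_of_nontrivial {k : Type v} [Field k] {Ω : ℕ+ → Type w} (A : Type u)
    [NonUnitalRing A] [Module k A] [IsScalarTower k A A] [SMulCommClass k A A]
    [OmegaAlgebra k Ω A] [Nontrivial A] :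
    ∃ (B : Type (max u v w)) (_ : NonUnitalRing B) (_ : Module k B) (_ : IsScalarTower k B B)
      (_ : SMulCommClass k B B) (_ : OmegaAlgebra k Ω B) (ι : Hom k Ω A B),
      Function.Injective ι ∧ IsSimple k Ω B ∧
        ∃ C : ℕ → Subalg k Ω B,
          (C 0).carrier = Set.range ι ∧
          (∀ n, ∃ h : (C n).toNonUnitalSubalgebra ≤ (C (n + 1)).toNonUnitalSubalgebra,
            IsStep (Subalg.inclusion h)) ∧
          (⋃ n, (C n).carrier) = Set.univ := by
  obtain ⟨C, j, h0, hj⟩ := exists_chain.{u} (k := k) (Ω := Ω)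
    { carrier := ULift.{max v w} A
      smulCommClass := ⟨fun c a b => ULift.ext _ _ (mul_smul_comm c a.down b.down).symm⟩ }
  -- Bijectivity makes the range of the composite with `ι 0` all of the first stage.
  obtain ⟨ι₀, hι₀⟩ : ∃ ι₀ : Hom k Ω A (C 0).carrier, Function.Bijective ι₀ := by
    rw [h0]
    exact ⟨Hom.up k Ω A, ULift.up_bijective⟩
  have : Nontrivial (C 0).carrier := hι₀.1.nontrivial
  obtain ⟨B, _, _, _, _, _, ι, hinj, hι, hsurj⟩ := exists_colimit j fun n => (hj n).1
  refine ⟨B, inferInstance, inferInstance, inferInstance, inferInstance, inferInstance,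
    (ι 0).comp ι₀, (hinj 0).comp hι₀.1, isSimple_of_chain (fun n => (hj n).2) hinj hι hsurj,
    fun n => (ι n).range, ?_, fun n => ⟨?_, ?_⟩, ?_⟩
  · exact (hι₀.2.range_comp (ι 0)).symm
  · rintro _ ⟨a, rfl⟩
    exact ⟨j n a, hι n a⟩
  · exact (hj n).2.of_bijective (Hom.rangeRestrict_bijective (hinj n))
      (Hom.rangeRestrict_bijective (hinj (n + 1))) fun a => Subtype.ext (hι n a).symm
  · refine Set.eq_univ_of_forall fun b => Set.mem_iUnion.2 ?_
    obtain ⟨n, a, rfl⟩ := hsurj b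
    exact ⟨n, a, rfl⟩

end Chain

end OmegaAlgebra

theorem mainTheorem9 {k : Type v} [Field k] {Ω : ℕ+ → Type w} (A : Type u)
    [NonUnitalRing A] [Module k A] [IsScalarTower k A A] [SMulCommClass k A A]
    [OmegaAlgebra k Ω A] :
    ∃ (B : Type (max u v w)) (_ : NonUnitalRing B) (_ : Module k B) (_ : IsScalarTower k B B)
      (_ : SMulCommClass k B B) (_ : OmegaAlgebra k Ω B) (ι : OmegaAlgebra.Hom k Ω A B),
      Function.Injective ι ∧ OmegaAlgebra.IsSimple k Ω B ∧
      (Nontrivial A →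
        ∃ C : ℕ → OmegaAlgebra.Subalg k Ω B,
          (C 0).carrier = Set.range ι ∧
          (∀ n, ∃ h : (C n).toNonUnitalSubalgebra ≤ (C (n + 1)).toNonUnitalSubalgebra,
            OmegaAlgebra.IsStep (OmegaAlgebra.Subalg.inclusion h)) ∧
          (⋃ n, (C n).carrier) = Set.univ) := by
  cases subsingleton_or_nontrivial A with
  | inl hA =>
    -- The zero algebra needs only some simple algebra as target; the chain starts at `k` with all
    -- operations zero.
    let _ : OmegaAlgebra k Ω (ULift.{u} k) := ⟨fun _ => 0⟩
    obtain ⟨B, _, _, _, _, _, _, _, hB, -⟩ :=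
      OmegaAlgebra.exists_simple_of_nontrivial (k := k) (Ω := Ω) (ULift.{u} k)
    refine ⟨B, inferInstance, inferInstance, inferInstance, inferInstance, inferInstance,
      ⟨0, fun δ _ => (OmegaAlgebra.op_zero δ).symm⟩, Function.injective_of_subsingleton _, hB,
      fun h => (not_subsingleton A hA).elim⟩
  | inr hA =>
    obtain ⟨B, h₁, h₂, h₃, h₄, h₅, ι, hι, hB, hC⟩ :=
      OmegaAlgebra.exists_simple_of_nontrivial (k := k) (Ω := Ω) A
    exact ⟨B, h₁, h₂, h₃, h₄, h₅, ι, hι, hB, fun _ => hC⟩
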